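/- Conventions. For $k\le\omega$, $(\omega)^k$ is the set of partitions of $\omega=\{0,1,2,\dots\}$ into exactly $k$ nonempty blocks; a partition $p$ with blocks $B^p_0,B^p_1,\dots$, indexed so that the least elements $\mu^p(i)=\min B^p_i$ increase with $i$, is identified with the function $p:\omega\to k$ with $p^{-1}(i)=B^p_i$. For $p\in(\omega)^\omega$, $(p)^k$ is the set of all $q\in(\omega)^k$ such that every $p$-block is contained in a $q$-block. For finite $k$, $(\omega)^k_{\mathrm{fin}}$ is the set of finite strings over $\{0,\dots,k-1\}$ in which every $i<k$ occurs and the first occurrences of $0,1,\dots,k-1$ come in this order. An $\ell$-coloring of a set $S$ is a family of sets with $S=\bigcup_{i<\ell}C_i$, not necessarily disjoint. For $y\in(\omega)^\omega$ and $m<k<\omega$, a coloring $(y)^k=\bigcup_{i<\ell}C_i$ is called $m$-reduced if any $p,q\in(y)^k$ with $p\upharpoonright\mu^p(m)=q\upharpoonright\mu^q(m)$ have the same color, i.e. $p\in C_i\Leftrightarrow q\in C_i$ for all $i<\ell$; it is called reduced if it is $(k-1)$-reduced. Theorem. Let $k$ and $\ell$ be natural numbers. (1) Let $1<m<k$, let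 $y\in(\omega)^\omega$, and let $(y)^k=\bigcup_{i<\ell}C_i$ be an $m$-reduced coloring. Then there is $x\in(y)^\omega$ such that the restriction of the coloring to $(x)^k$ is $(m-1)$-reduced. (2) Let $k\ge 2$. For every $y\in(\omega)^\omega$ and every reduced coloring $(y)^k=\bigcup_{i<\ell}C_i$ there are $p\in(y)^\omega$ and $i<\ell$ such that $(p)^k\subseteq C_i$. (3) ($\mathsf{CDRT}^k_\ell$, the Combinatorial Dual Ramsey Theorem.) Let $k\ge 2$. For every coloring $(\omega)^{k-1}_{\mathrm{fin}}=\bigcup_{i<\ell}C_i$ there are $p\in(\omega)^\omega$ and $i<\ell$ such that $x\upharpoonright\mu^x(k-1)\in C_i$ for all $x\in(p)^k$. -/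

import Mathlib

namespace DualRamsey

/-- A function `f : ω → ω` is ordered if, whenever the value `i` is taken at `n`,
every `j < i` is taken at some argument below `n`. -/
def IsOrdered (f : ℕ → ℕ) : Prop :=
  ∀ n i, f n = i → ∀ j < i, ∃ m < n, f m = j

/-- A finite string is ordered if it satisfies the analogous condition. -/
def IsOrderedString (σ : List ℕ) : Prop :=
  ∀ n i : ℕ, σ[n]? = some i → ∀ j < i, ∃ m : ℕ, m < n ∧ σ[m]? = some j

/-- `(ω)^k` for `k ≤ ω` (`⊤` stands for `ω`): the `k`-partitions of `ω`, that is, the ordered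
functions on `ω` whose set of values is exactly `{i | i < k}`. The block `B_i^p` is
`p ⁻¹' {i}`. -/
def partitions (k : ℕ∞) : Set (ℕ → ℕ) :=
  {p | IsOrdered p ∧ Set.range p = {i : ℕ | (i : ℕ∞) < k}}

/-- `(ω)^k_fin` for finite `k`: the ordered strings over `k` in which all `i < k` appear. -/
def finPartitions (k : ℕ) : Set (List ℕ) :=
  {σ | IsOrderedString σ ∧ ∀ i, i ∈ σ ↔ i < k}

/-- `(p)^k`: the `k`-coarsenings of `p`. -/
def coarsenings (p : ℕ → ℕ) (k : ℕ∞) : Set (ℕ → ℕ) :=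
  {q | q ∈ partitions k ∧ ∀ n m, p n = p m → q n = q m}

/-- `μ^p(i)`: the least element of the block `B_i^p` (only used for nonempty blocks). -/
noncomputable def blockMin (p : ℕ → ℕ) (i : ℕ) : ℕ :=
  sInf {n | p n = i}

/-- `p ↾ n`: the string `p(0), …, p(n-1)`. -/
def initialString (p : ℕ → ℕ) (n : ℕ) : List ℕ :=
  (List.range n).map p

/-- The sets `C i`, `i < ℓ`, form a coloring `(y)^k = ⋃_{i < ℓ} C i`; colors may overlap. -/
def IsColoring {ℓ : ℕ} (y : ℕ → ℕ) (k : ℕ) (C : Fin ℓ → Set (ℕ → ℕ)) : Prop :=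
  coarsenings y k = ⋃ i, C i

/-- The coloring `C` of `(y)^k` is `m`-reduced: if `p, q ∈ (y)^k` satisfy
`p ↾ μ^p(m) = q ↾ μ^q(m)`, then `p` and `q` belong to the same colors. -/
def IsMReduced {ℓ : ℕ} (y : ℕ → ℕ) (k m : ℕ) (C : Fin ℓ → Set (ℕ → ℕ)) : Prop :=
  ∀ p ∈ coarsenings y k, ∀ q ∈ coarsenings y k,
    initialString p (blockMin p m) = initialString q (blockMin q m) →
      ∀ i, p ∈ C i ↔ q ∈ C i

/-- The restriction to `(x)^k` of a coloring. -/
def restrictColoring {ℓ : ℕ} (x : ℕ → ℕ) (k : ℕ) (C : Fin ℓ → Set (ℕ → ℕ)) :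
    Fin ℓ → Set (ℕ → ℕ) :=
  fun i => C i ∩ coarsenings x k

/-- The Combinatorial Dual Ramsey Theorem for `k`-partitions and `ℓ` colors: for every coloring
`(ω)^{k-1}_fin = ⋃_{i < ℓ} C i` there are `p ∈ (ω)^ω` and a color `i` such that
`x ↾ μ^x(k-1) ∈ C i` for all `x ∈ (p)^k`. -/
def CDRT (k ℓ : ℕ) : Prop :=
  ∀ C : Fin ℓ → Set (List ℕ), finPartitions (k - 1) = ⋃ i, C i →
    ∃ p ∈ partitions ⊤, ∃ i, ∀ x ∈ coarsenings p k,
      initialString x (blockMin x (k - 1)) ∈ C i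

end DualRamsey

namespace DualRamsey

/-! By `exists_comp_of_mem_coarsenings`, the `k`-coarsenings of an infinite partition `x` are
exactly the `p ∘ x` with `p` a `k`-partition. Passing to a coarsening is thus precomposition, and an
`m`-reduced coloring becomes a function of `p` invariant below `m`. The heart is
`InvariantBelow.exists_pred`, which lowers `m` by one. Iterated down to `0`, where any two
partitions agree, it makes the coloring constant.

Suppose the color depends only on `p` below the first `m + 1`, and fix a beginning `p 0, …, p n`
that ends with the first `m`. What remains is a coloring of finite words over the letters `0, …, m`.
`carlson_simpson` gives an infinite variable word on which it is constant; reading letters as old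
blocks and variables as new ones yields an infinite partition fixing `0, …, n`. Each `n` has
finitely many such beginnings, and `exists_fusion` treats all `n` together.

The Carlson–Simpson lemma rests on an ultrafilter `q` on variable words with `q[a] * q = q` for
every letter `a`, obtained from a minimal idempotent. The infinite word is a concatenation of words
typical for `q`. -/

/-! ### Idempotents in compact right topological semigroups -/

/-- A closed subsemigroup of a compact right topological semigroup contains an idempotent
which is minimal among the idempotents of the subsemigroup. -/
theorem exists_minimal_idempotent {M : Type*} [Semigroup M] [TopologicalSpace M] [CompactSpace M]
    [T2Space M] (hcont : ∀ r : M, Continuous (· * r)) (S : Set M) (hne : S.Nonempty)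
    (hcl : IsClosed S) (hmul : ∀ x ∈ S, ∀ y ∈ S, x * y ∈ S) :
    ∃ p ∈ S, p * p = p ∧ ∀ e ∈ S, e * e = e → e * p = e → p * e = e → e = p := by
  let I : Set (Set M) :=
    {L | L ⊆ S ∧ IsClosed L ∧ L.Nonempty ∧ ∀ s ∈ S, ∀ l ∈ L, s * l ∈ L}
  obtain ⟨L, -, hL⟩ : ∃ L, L ⊆ S ∧ Minimal (· ∈ I) L := by
    refine zorn_superset_nonempty I (fun c hcI hc hcne => ?_) S ⟨subset_rfl, hcl, hne, hmul⟩
    refine ⟨⋂₀ c, ⟨?_, isClosed_sInter fun t ht => (hcI ht).2.1, ?_, fun s hs l hl => ?_⟩,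
      fun s hs => Set.sInter_subset_of_mem hs⟩
    · obtain ⟨t, ht⟩ := hcne
      exact (Set.sInter_subset_of_mem ht).trans (hcI ht).1
    · have := hcne.coe_sort
      rw [Set.sInter_eq_iInter]
      exact IsCompact.nonempty_iInter_of_directed_nonempty_isCompact_isClosed
        ((↑) : c → Set M) (DirectedOn.directed_val (IsChain.directedOn hc.symm))
        (fun i => (hcI i.prop).2.2.1) (fun i => (hcI i.prop).2.1.isCompact)
        (fun i => (hcI i.prop).2.1)
    · exact Set.mem_sInter.2 fun t ht => (hcI ht).2.2.2 s hs l (Set.mem_sInter.1 hl t ht)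
  obtain ⟨hLS, hLcl, hLne, hLmul⟩ := hL.prop
  obtain ⟨p, hpL, hpp⟩ := exists_idempotent_in_compact_subsemigroup hcont L hLne hLcl.isCompact
    (fun x hx y hy => hLmul x (hLS hx) y hy)
  refine ⟨p, hLS hpL, hpp, fun e heS hee hep hpe => ?_⟩
  have heL : e ∈ L := hep ▸ hLmul e heS p hpL
  -- `S * e` is a closed left ideal of `S` inside the minimal one `L`, so it equals `L`. Then `p = x
  -- * e` for some `x`, which gives `p * e = p`.
  have hEq : Set.image (· * e) S = L := by
    apply hL.eq_of_subset
    · refine ⟨?_, (hcont e).isClosedMap _ hcl, hne.image _, ?_⟩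
      · rintro _ ⟨x, hx, rfl⟩
        exact hmul x hx e heS
      · rintro s hs _ ⟨x, hx, rfl⟩
        exact ⟨s * x, hmul s hs x hx, mul_assoc _ _ _⟩
    · rintro _ ⟨x, hx, rfl⟩
      exact hLmul x hx e heL
  rw [← hEq] at hpL
  obtain ⟨x, -, hx⟩ := hpL
  simp only at hx
  rw [← hpe, ← hx, mul_assoc, hee]

/-- If `S` is a closed subsemigroup and `J` a closed two-sided ideal of a compact right topological
semigroup, then some `q ∈ J` absorbs, from the left, all of its images under the retractions
onto `S`. -/
theorem exists_mem_retract_mul_eq {M ι : Type*} [Semigroup M] [TopologicalSpace M] [CompactSpace M]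
    [T2Space M] (hcont : ∀ r : M, Continuous (· * r)) (S J : Set M) (hSne : S.Nonempty)
    (hScl : IsClosed S) (hSmul : ∀ x ∈ S, ∀ y ∈ S, x * y ∈ S) (hJne : J.Nonempty)
    (hJcl : IsClosed J) (hJl : ∀ x, ∀ j ∈ J, x * j ∈ J) (hJr : ∀ x, ∀ j ∈ J, j * x ∈ J)
    (T : ι → M → M) (hTmul : ∀ a x y, T a (x * y) = T a x * T a y) (hTS : ∀ a x, T a x ∈ S)
    (hTid : ∀ a, ∀ x ∈ S, T a x = x) :
    ∃ q ∈ J, ∀ a, T a q * q = q := by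
  obtain ⟨p, hpS, hpp, hmin⟩ := exists_minimal_idempotent hcont S hSne hScl hSmul
  -- An idempotent `r` of `J * p` satisfies `r * p = r`, so `p * r` is an idempotent of `J` lying
  -- below `p`.
  obtain ⟨r, ⟨j, hj, hjr⟩, hrr⟩ := exists_idempotent_in_compact_subsemigroup hcont
    (Set.image (· * p) J)
    (hJne.image _) ((hcont p).isClosedMap _ hJcl).isCompact (by
      rintro _ ⟨x, hx, rfl⟩ _ ⟨y, hy, rfl⟩
      exact ⟨x * p * y, hJl _ y hy, mul_assoc _ _ _⟩)
  simp only at hjr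
  have hrp : r * p = r := by rw [← hjr, mul_assoc, hpp]
  have hpq : p * (p * r) = p * r := by rw [← mul_assoc, hpp]
  have hqp : p * r * p = p * r := by rw [mul_assoc, hrp]
  have hqq : p * r * (p * r) = p * r := by rw [← mul_assoc, hqp, mul_assoc, hrr]
  refine ⟨p * r, hJl _ _ (hjr ▸ hJr _ _ hj), fun a => ?_⟩
  have hTp : T a p = p := hTid a p hpS
  -- The retraction fixes `p` and preserves products, so it sends `p * r` to an idempotent of `S`
  -- below `p`. Minimality makes this `p` itself.
  have : T a (p * r) = p := by
    refine hmin _ (hTS a _) (by rw [← hTmul, hqq]) ?_ ?_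
    · nth_rw 2 [← hTp]
      rw [← hTmul, hqp]
    · nth_rw 1 [← hTp]
      rw [← hTmul, hpq]
  rw [this, hpq]

-- Ultrafilters on variable words

attribute [local instance] Ultrafilter.mul Ultrafilter.semigroup

theorem ultrafilter_map_mul {M N : Type*} [Monoid M] [Monoid N] (f : M →* N) (U V : Ultrafilter M) :
    (U * V).map f = U.map f * V.map f := by
  refine Ultrafilter.coe_inj.mp (Filter.ext' fun p => ?_)
  rw [Ultrafilter.eventually_mul, Ultrafilter.coe_map, Ultrafilter.coe_map, Ultrafilter.coe_map,
    Filter.eventually_map, Filter.eventually_map, Ultrafilter.eventually_mul]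
  simp only [Filter.eventually_map, map_mul]

/-- The substitution of the letter `a` for the variable `none`. -/
def substVar {A : Type*} (a : A) : FreeMonoid (Option A) →* FreeMonoid (Option A) :=
  FreeMonoid.map fun o => some (o.getD a)

theorem substVar_eq {A : Type*} (a : A) (w : FreeMonoid (Option A)) :
    substVar a w = FreeMonoid.ofList (w.toList.map fun o => some (o.getD a)) := rfl

/-- There is an ultrafilter `q` on the variable words over `A` which is absorbed by all of its
images under substitution of a letter for the variable. -/
theorem exists_variable_word_ultrafilter (A : Type*) :
    ∃ q : Ultrafilter (FreeMonoid (Option A)),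
      (∀ᶠ w in (q : Filter (FreeMonoid (Option A))), none ∈ FreeMonoid.toList w) ∧
      ∀ a : A, q.map (substVar a) * q = q := by
  let V : Set (FreeMonoid (Option A)) := {w | none ∈ w.toList}
  let S : Set (Ultrafilter (FreeMonoid (Option A))) := {U | Vᶜ ∈ U}
  let J : Set (Ultrafilter (FreeMonoid (Option A))) := {U | V ∈ U}
  have hone : S.Nonempty := by
    refine ⟨pure 1, ?_⟩
    change Vᶜ ∈ (pure 1 : Ultrafilter (FreeMonoid (Option A)))
    rw [Ultrafilter.mem_pure]
    simp [V]
  have hvar : J.Nonempty := by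
    refine ⟨pure (FreeMonoid.of none), ?_⟩
    change V ∈ (pure (FreeMonoid.of none) : Ultrafilter (FreeMonoid (Option A)))
    rw [Ultrafilter.mem_pure]
    simp [V]
  have hSmul : ∀ U ∈ S, ∀ U' ∈ S, U * U' ∈ S := by
    intro U hU U' hU'
    change ∀ᶠ w in ((U * U' : Ultrafilter _) : Filter _), w ∈ Vᶜ
    rw [Ultrafilter.eventually_mul]
    filter_upwards [hU] with x hx
    filter_upwards [hU'] with y hy
    simp only [V, Set.mem_compl_iff, Set.mem_ofPred_eq] at hx hy
    simp [V, FreeMonoid.toList_mul, hx, hy]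
  have hl : ∀ U, ∀ U' ∈ J, U * U' ∈ J := by
    intro U U' hU'
    change ∀ᶠ w in ((U * U' : Ultrafilter _) : Filter _), w ∈ V
    rw [Ultrafilter.eventually_mul]
    refine Filter.Eventually.of_forall fun x => ?_
    filter_upwards [hU'] with y hy
    simp only [V, Set.mem_ofPred_eq] at hy
    simp [V, FreeMonoid.toList_mul, hy]
  have hr : ∀ U', ∀ U ∈ J, U * U' ∈ J := by
    intro U' U hU
    change ∀ᶠ w in ((U * U' : Ultrafilter _) : Filter _), w ∈ V
    rw [Ultrafilter.eventually_mul]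
    filter_upwards [hU] with x hx
    refine Filter.Eventually.of_forall fun y => ?_
    simp only [V, Set.mem_ofPred_eq] at hx
    simp [V, FreeMonoid.toList_mul, hx]
  have hTS : ∀ (a : A) (U : Ultrafilter (FreeMonoid (Option A))), U.map (substVar a) ∈ S := by
    intro a U
    change Vᶜ ∈ U.map (substVar a)
    rw [Ultrafilter.mem_map]
    refine Filter.univ_mem' fun x => ?_
    simp [V, substVar_eq]
  have hTid : ∀ (a : A), ∀ U ∈ S, U.map (substVar a) = U := by
    intro a U hU
    refine Ultrafilter.coe_inj.mp ?_
    rw [Ultrafilter.coe_map]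
    refine (Filter.map_congr ?_).trans Filter.map_id
    filter_upwards [hU] with x hx
    simp only [V, Set.mem_compl_iff, Set.mem_ofPred_eq] at hx
    change FreeMonoid.ofList _ = FreeMonoid.ofList x.toList
    congr 1
    refine (List.map_congr_left fun o ho => ?_).trans (List.map_id _)
    cases o with
    | none => exact absurd ho hx
    | some b => rfl
  exact exists_mem_retract_mul_eq Ultrafilter.continuous_mul_left S J hone
    (ultrafilter_isClosed_basic _) hSmul hvar (ultrafilter_isClosed_basic _) hl hr
    (fun a U => U.map (substVar a)) (fun a => ultrafilter_map_mul (substVar a)) hTS hTid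

/-- The previous theorem, stated for lists and in terms of properties of words. -/
theorem exists_ultrafilter_list (A : Type*) :
    ∃ q : Ultrafilter (List (Option A)), (∀ᶠ w in (q : Filter (List (Option A))), none ∈ w) ∧
      ∀ (a : A) (P : List (Option A) → Prop), (∀ᶠ w in (q : Filter (List (Option A))), P w) →
        ∀ᶠ w in (q : Filter (List (Option A))), ∀ᶠ u in (q : Filter (List (Option A))),
          P (w.map (fun o => some (o.getD a)) ++ u) := by
  obtain ⟨q, hq, hqa⟩ := exists_variable_word_ultrafilter A
  refine ⟨q.map FreeMonoid.toList, hq, fun a P hP => ?_⟩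
  rw [Ultrafilter.coe_map, Filter.eventually_map] at hP ⊢
  rw [← hqa a, Ultrafilter.eventually_mul, Ultrafilter.coe_map, Filter.eventually_map] at hP
  exact hP

/-! ### The Carlson–Simpson lemma -/

/-- The part of a variable word before the first occurrence of the variable. -/
def constPart {A : Type*} : List (Option A) → List A
  | [] => []
  | none :: _ => []
  | some a :: l => a :: constPart l

theorem constPart_map_some_append {A : Type*} (s : List A) (l : List (Option A)) :
    constPart (s.map some ++ l) = s ++ constPart l := by
  induction s with
  | nil => rfl
  | cons a s ih => simp [constPart, ih]

theorem exists_eq_of_none_mem {A : Type*} (w : List (Option A)) (h : none ∈ w) :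
    ∃ (s : List A) (r : List (Option A)), w = s.map some ++ none :: r := by
  induction w with
  | nil => simp at h
  | cons o w ih =>
    cases o with
    | none => exact ⟨[], w, rfl⟩
    | some a =>
      obtain ⟨s, r, rfl⟩ := ih (by simpa using h)
      exact ⟨a :: s, r, rfl⟩

/-- The word in `A` and the variables indexed by `ℕ` which arises from a variable word by naming
its variable `J`. -/
def nameVar {A : Type*} (J : ℕ) (w : List (Option A)) : List (A ⊕ ℕ) :=
  w.map fun o => o.elim (Sum.inr J) Sum.inl

/-- The substitution of the letters `α j` for the variables `j`. -/
def substVars {A : Type*} (α : ℕ → A) (L : List (A ⊕ ℕ)) : List A :=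
  L.map (Sum.elim id α)

/-- One step of the construction of the infinite word. The invariant is that every instance of `L`,
followed by a `q`-typical word, satisfies `D`. A typical `w` preserves it: by the absorption
property, `w` may be replaced by any `w[a]` followed by another typical word. Finitely many
conditions on `w` suffice, since `L` has finitely many instances and `A` finitely many letters. -/
theorem exists_extension {A : Type*} [Finite A] {q : Ultrafilter (List (Option A))}
    (hq : ∀ᶠ w in (q : Filter (List (Option A))), none ∈ w)
    (hqa : ∀ (a : A) (P : List (Option A) → Prop), (∀ᶠ w in (q : Filter (List (Option A))), P w) →
      ∀ᶠ w in (q : Filter (List (Option A))), ∀ᶠ u in (q : Filter (List (Option A))),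
        P (w.map (fun o => some (o.getD a)) ++ u))
    {D : List (Option A) → Prop} (J : ℕ) (L : List (A ⊕ ℕ))
    (hL : ∀ α : ℕ → A, ∀ᶠ u in (q : Filter (List (Option A))), D ((substVars α L).map some ++ u)) :
    ∃ w : List (Option A), none ∈ w ∧ (∀ α : ℕ → A, D ((substVars α L).map some ++ w)) ∧
      ∀ α : ℕ → A, ∀ᶠ u in (q : Filter (List (Option A))),
        D ((substVars α (L ++ nameVar J w)).map some ++ u) := by
  have hfin : (Set.range fun α : ℕ → A => substVars α L).Finite := by
    refine (List.finite_length_eq A L.length).subset ?_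
    rintro _ ⟨α, rfl⟩
    simp [substVars]
  have h1 : ∀ᶠ w in (q : Filter (List (Option A))), ∀ l ∈ Set.range fun α : ℕ → A => substVars α L,
      D (l.map some ++ w) := by
    rw [Filter.eventually_all_finite hfin]
    rintro _ ⟨α, rfl⟩
    exact hL α
  have h2 : ∀ᶠ w in (q : Filter (List (Option A))),
      ∀ l ∈ Set.range fun α : ℕ → A => substVars α L, ∀ a : A,
      ∀ᶠ u in (q : Filter (List (Option A))),
        D (l.map some ++ (w.map (fun o => some (o.getD a)) ++ u)) := by
    rw [Filter.eventually_all_finite hfin]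
    rintro _ ⟨α, rfl⟩
    rw [Filter.eventually_all]
    exact fun a => hqa a (fun x => D ((substVars α L).map some ++ x)) (hL α)
  obtain ⟨w, hw, hw1, hw2⟩ := (hq.and (h1.and h2)).exists
  refine ⟨w, hw, fun α => hw1 _ ⟨α, rfl⟩, fun α => ?_⟩
  filter_upwards [hw2 _ ⟨α, rfl⟩ (α J)] with u hu
  convert hu using 1
  simp only [substVars, nameVar, List.map_append, List.map_map, List.append_assoc]
  congr 2
  refine List.map_congr_left fun o _ => ?_
  cases o <;> rfl

/-- An increasing sequence of lists of unbounded length has an infinite limit word. -/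
theorem exists_limit_word {B : Type*} (b : B) (L : ℕ → List B) (hL : ∀ J, L J <+: L (J + 1))
    (hlen : ∀ J, J ≤ (L J).length) :
    ∃ W : ℕ → B, ∀ J, ∀ l, l <+: L J → l = (List.range l.length).map W := by
  have hmono : ∀ J J', J ≤ J' → L J <+: L J' := by
    intro J J' h
    induction h with
    | refl => exact List.prefix_rfl
    | step _ ih => exact ih.trans (hL _)
  refine ⟨fun i => (L (i + 1))[i]?.getD b, fun J l hl => ?_⟩
  refine List.ext_getElem (by simp) fun i h1 h2 => ?_
  have hi : i < (L (i + 1)).length := hlen (i + 1)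
  simp only [List.getElem_map, List.getElem_range, List.getElem?_eq_getElem hi, Option.getD_some]
  rcases le_total J (i + 1) with h | h
  · exact (hl.trans (hmono _ _ h)).getElem h1
  · rw [hl.getElem h1, (hmono _ _ h).getElem hi]

/-- The lemma of Carlson and Simpson: for every finite coloring of the words over a finite
alphabet `A` there is an infinite word `W` in letters and variables such that all words which arise
from `W` by truncation before the first occurrence `N J` of a variable `J` and substitution for
the variables have the same color. -/
theorem carlson_simpson {A K : Type*} [Finite A] [Finite K] (c : List A → K) :
    ∃ (W : ℕ → A ⊕ ℕ) (N : ℕ → ℕ) (κ : K), ∀ J, W (N J) = Sum.inr J ∧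
      (∀ i < N J, ∀ j, W i = Sum.inr j → j < J) ∧
      ∀ α : ℕ → A, c (substVars α ((List.range (N J)).map W)) = κ := by
  obtain ⟨q, hq, hqa⟩ := exists_ultrafilter_list A
  -- Variable words are colored by their part before the first variable; `κ` is the color that `q`
  -- selects.
  obtain ⟨κ, hκ⟩ : ∃ κ : K, ∀ᶠ w in (q : Filter (List (Option A))), c (constPart w) = κ := by
    by_contra! h
    have : ∀ᶠ w in (q : Filter (List (Option A))), ∀ κ : K, c (constPart w) ≠ κ :=
      Filter.eventually_all.2 h
    obtain ⟨w, hw⟩ := this.exists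
    exact hw _ rfl
  let State := {L : List (A ⊕ ℕ) // ∀ α : ℕ → A, ∀ᶠ u in (q : Filter (List (Option A))),
    c (constPart ((substVars α L).map some ++ u)) = κ}
  have hstep : ∀ (J : ℕ) (S : State), ∃ (S' : State) (s : List A) (r : List (Option A)),
      S'.1 = S.1 ++ nameVar J (s.map some ++ none :: r) ∧
      ∀ α, c (substVars α S.1 ++ s) = κ := by
    rintro J ⟨L, hL⟩
    obtain ⟨w, hw, hw1, hw2⟩ := exists_extension hq hqa
      (D := fun w => c (constPart w) = κ) J L hL
    obtain ⟨s, r, rfl⟩ := exists_eq_of_none_mem w hw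
    refine ⟨⟨_, hw2⟩, s, r, rfl, fun α => ?_⟩
    have := hw1 α
    rwa [constPart_map_some_append, constPart_map_some_append, constPart, List.append_nil] at this
  choose next s r hnext hcol using hstep
  let S : ℕ → State := fun J => Nat.rec ⟨[], fun _ => hκ⟩ next J
  let L : ℕ → List (A ⊕ ℕ) := fun J => (S J).1
  have hLs : ∀ J, L (J + 1) = L J ++ nameVar J ((s J (S J)).map some ++ none :: r J (S J)) :=
    fun J => hnext J (S J)
  have hLpre : ∀ J, (L J ++ (s J (S J)).map Sum.inl) ++ [Sum.inr J] <+: L (J + 1) := by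
    intro J
    rw [hLs]
    refine ⟨nameVar J (r J (S J)), ?_⟩
    simp [nameVar]
  have hlen : ∀ J, J ≤ (L J).length := by
    intro J
    induction J with
    | zero => exact Nat.zero_le _
    | succ J ih =>
      have := (hLpre J).length_le
      simp only [List.length_append, List.length_map, List.length_singleton] at this
      omega
  have hvar : ∀ J, ∀ j, Sum.inr j ∈ L J → j < J := by
    intro J
    induction J with
    | zero => intro j hj; exact absurd hj List.not_mem_nil
    | succ J ih =>
      intro j hj
      rw [hLs, List.mem_append] at hj
      rcases hj with hj | hj
      · exact (ih j hj).trans (Nat.lt_succ_self J)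
      · obtain ⟨o, -, ho⟩ := List.mem_map.1 hj
        cases o with
        | none => simp at ho; omega
        | some a => simp at ho
  obtain ⟨W, hW⟩ := exists_limit_word (Sum.inr 0) L
    (fun J => by rw [hLs]; exact List.prefix_append _ _) hlen
  -- The `J`-th appended word is `s`, then its variable, then `r`. Hence variable `J` first occurs
  -- right after `L J` and `s`.
  refine ⟨W, fun J => (L J ++ (s J (S J)).map Sum.inl).length, κ, fun J => ?_⟩
  have h1 := hW (J + 1) _ ((List.prefix_append _ _).trans (hLpre J))
  have h2 := hW (J + 1) _ (hLpre J)
  rw [List.length_append, List.length_singleton, List.range_succ, List.map_append, ← h1] at h2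
  refine ⟨?_, fun i hi j hj => ?_, fun α => ?_⟩
  · simpa using (List.append_cancel_left h2).symm
  · have : Sum.inr j ∈ L J ++ (s J (S J)).map Sum.inl := by
      rw [h1, ← hj]
      exact List.mem_map_of_mem (List.mem_range.2 hi)
    simp only [List.mem_append, List.mem_map, reduceCtorEq, and_false, exists_false,
      or_false] at this
    exact hvar J j this
  · rw [← h1]
    have := hcol J (S J) α
    convert this using 2
    simp [substVars, L]

/-! ### Partitions as ordered functions under composition -/

theorem mem_partitions_top {p : ℕ → ℕ} :
    p ∈ partitions ⊤ ↔ IsOrdered p ∧ Function.Surjective p := by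
  simp only [partitions, Set.mem_ofPred_eq, Set.ext_iff, Set.mem_range, ENat.natCast_lt_top,
    iff_true]
  rfl

theorem mem_partitions_coe {p : ℕ → ℕ} {k : ℕ} :
    p ∈ partitions k ↔ IsOrdered p ∧ ∀ i, (∃ n, p n = i) ↔ i < k := by
  simp only [partitions, Set.mem_ofPred_eq, Set.ext_iff, Set.mem_range, Nat.cast_lt]

theorem IsOrdered.le {p : ℕ → ℕ} (hp : IsOrdered p) (n : ℕ) : p n ≤ n := by
  induction n using Nat.strong_induction_on with
  | _ n ih =>
    rcases Nat.eq_zero_or_pos (p n) with h | h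
    · omega
    · obtain ⟨m, hm, hpm⟩ := hp n _ rfl (p n - 1) (by omega)
      have := ih m hm
      omega

theorem IsOrdered.comp {g x : ℕ → ℕ} (hg : IsOrdered g) (hx : IsOrdered x) :
    IsOrdered (g ∘ x) := by
  intro n i hi j hj
  obtain ⟨m', hm', rfl⟩ := hg (x n) i hi j hj
  obtain ⟨m, hm, rfl⟩ := hx n _ rfl m' hm'
  exact ⟨m, hm, rfl⟩

theorem comp_mem_partitions {k : ℕ∞} {g x : ℕ → ℕ} (hg : g ∈ partitions k)
    (hx : x ∈ partitions ⊤) : g ∘ x ∈ partitions k := by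
  obtain ⟨hx1, hx2⟩ := mem_partitions_top.1 hx
  exact ⟨hg.1.comp hx1, by rw [hx2.range_comp]; exact hg.2⟩

theorem id_mem_partitions_top : id ∈ partitions ⊤ :=
  mem_partitions_top.2 ⟨fun _ _ hi j hj => ⟨j, hj.trans_eq hi.symm, rfl⟩, Function.surjective_id⟩

theorem apply_blockMin {p : ℕ → ℕ} {i : ℕ} (h : ∃ n, p n = i) : p (blockMin p i) = i :=
  Nat.sInf_mem (s := {n | p n = i}) h

theorem IsOrdered.lt_of_lt_blockMin {p : ℕ → ℕ} (hp : IsOrdered p) {i n : ℕ}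
    (h : n < blockMin p i) : p n < i := by
  by_contra! hle
  rcases hle.eq_or_lt with h' | h'
  · exact Nat.notMem_of_lt_sInf h h'.symm
  · obtain ⟨m, hm, hpm⟩ := hp n _ rfl i h'
    exact Nat.notMem_of_lt_sInf (hm.trans h) hpm

theorem blockMin_eq {p : ℕ → ℕ} {i n : ℕ} (hn : p n = i) (hlt : ∀ j < n, p j ≠ i) :
    blockMin p i = n :=
  le_antisymm (Nat.sInf_le hn) <| by
    by_contra! h
    exact hlt _ h (apply_blockMin ⟨n, hn⟩)

/-- The coarsenings of an infinite partition `p` are the compositions with `p`. -/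
theorem exists_comp_of_mem_coarsenings {k : ℕ∞} {p q : ℕ → ℕ} (hp : p ∈ partitions ⊤)
    (hq : q ∈ coarsenings p k) : ∃ h ∈ partitions k, q = h ∘ p := by
  obtain ⟨hp1, hp2⟩ := mem_partitions_top.1 hp
  have hcomp : q = (fun i => q (blockMin p i)) ∘ p :=
    funext fun n => hq.2 _ _ (apply_blockMin ⟨n, rfl⟩).symm
  refine ⟨fun i => q (blockMin p i), ⟨fun n i hi j hj => ?_, ?_⟩, hcomp⟩
  · obtain ⟨m, hm, hqm⟩ := hq.1.1 _ i hi j hj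
    exact ⟨p m, hp1.lt_of_lt_blockMin hm, by rw [← hqm]; exact (congrFun hcomp m).symm⟩
  · rw [← hp2.range_comp, ← hcomp]
    exact hq.1.2

theorem comp_mem_coarsenings {k : ℕ∞} {h p : ℕ → ℕ} (hh : h ∈ partitions k)
    (hp : p ∈ partitions ⊤) : h ∘ p ∈ coarsenings p k :=
  ⟨comp_mem_partitions hh hp, fun _ _ e => congrArg h e⟩

/-- `p` and `q` agree below the common least element of their `m`-th blocks. -/
def AgreeBelow (m : ℕ) (p q : ℕ → ℕ) : Prop :=
  ∃ N, (∀ i < N, p i = q i ∧ p i < m) ∧ p N = m ∧ q N = m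

/-- The length of the string is the least element of the `m`-th block, so equal strings force a
common one. `AgreeBelow` avoids `sInf` and behaves well under composition. -/
theorem initialString_eq_iff_agreeBelow {k m : ℕ} (hm : m < k) {p q : ℕ → ℕ}
    (hp : p ∈ partitions k) (hq : q ∈ partitions k) :
    initialString p (blockMin p m) = initialString q (blockMin q m) ↔ AgreeBelow m p q := by
  obtain ⟨hp1, hp2⟩ := mem_partitions_coe.1 hp
  obtain ⟨hq1, hq2⟩ := mem_partitions_coe.1 hq
  constructor
  · intro h
    have hlen : blockMin p m = blockMin q m := by
      simpa [initialString] using congrArg List.length h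
    refine ⟨blockMin p m, fun i hi => ⟨?_, hp1.lt_of_lt_blockMin hi⟩,
      apply_blockMin ((hp2 m).2 hm), hlen ▸ apply_blockMin ((hq2 m).2 hm)⟩
    rw [← hlen] at h
    exact List.map_inj_left.1 h i (List.mem_range.2 hi)
  · rintro ⟨N, hN, hpN, hqN⟩
    rw [blockMin_eq hpN fun j hj => (hN j hj).2.ne,
      blockMin_eq hqN fun j hj => (hN j hj).1 ▸ (hN j hj).2.ne]
    exact List.map_congr_left fun i hi => (hN i (List.mem_range.1 hi)).1

/-- Before its first value `N`, an ordered surjection `x` takes exactly the values below `N`.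
Composition with `x` thus only moves the first occurrence of `m` from `N` to `blockMin x N`. -/
theorem agreeBelow_comp_iff {m : ℕ} {p q x : ℕ → ℕ} (hx : x ∈ partitions ⊤) :
    AgreeBelow m (p ∘ x) (q ∘ x) ↔ AgreeBelow m p q := by
  obtain ⟨hx1, hx2⟩ := mem_partitions_top.1 hx
  constructor
  · rintro ⟨N, hN, hpN, hqN⟩
    refine ⟨x N, fun i hi => ?_, hpN, hqN⟩
    obtain ⟨j, hj, rfl⟩ := hx1 N _ rfl i hi
    exact hN j hj
  · rintro ⟨N, hN, hpN, hqN⟩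
    have h := apply_blockMin (hx2 N)
    exact ⟨blockMin x N, fun i hi => hN _ (hx1.lt_of_lt_blockMin hi),
      by rw [Function.comp_apply, h, hpN], by rw [Function.comp_apply, h, hqN]⟩

theorem agreeBelow_zero {k : ℕ∞} {p q : ℕ → ℕ} (hp : p ∈ partitions k) (hq : q ∈ partitions k) :
    AgreeBelow 0 p q :=
  ⟨0, fun _ hi => absurd hi (Nat.not_lt_zero _), Nat.le_zero.1 (hp.1.le 0),
    Nat.le_zero.1 (hq.1.le 0)⟩

/-! ### Partitions built from words -/

/-- The `k`-partition which starts with `p 0, …, p n`, continues with the word `τ`, and then takes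
the values `m + 1, m + 2, …, k - 1, k - 1, …`. -/
def extendPartition (p : ℕ → ℕ) (k m n : ℕ) (τ : List ℕ) (i : ℕ) : ℕ :=
  if i ≤ n then p i else
    τ[i - (n + 1)]?.getD (min (m + 1 + (i - (n + 1) - τ.length)) (k - 1))

theorem extendPartition_of_le {p : ℕ → ℕ} {k m n : ℕ} {τ : List ℕ} {i : ℕ} (h : i ≤ n) :
    extendPartition p k m n τ i = p i := if_pos h

theorem extendPartition_word {p : ℕ → ℕ} {k m n : ℕ} {τ : List ℕ} {i : ℕ} (h : i < τ.length) :
    extendPartition p k m n τ (n + 1 + i) = τ[i] := by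
  rw [extendPartition, if_neg (by omega), Nat.add_sub_cancel_left, List.getElem?_eq_getElem h,
    Option.getD_some]

theorem extendPartition_tail {p : ℕ → ℕ} {k m n : ℕ} {τ : List ℕ} {d : ℕ} :
    extendPartition p k m n τ (n + 1 + (τ.length + d)) = min (m + 1 + d) (k - 1) := by
  rw [extendPartition, if_neg (by omega), Nat.add_sub_cancel_left,
    List.getElem?_eq_none (by omega), Option.getD_none, Nat.add_sub_cancel_left]

theorem extendPartition_cases (n l i : ℕ) :
    i ≤ n ∨ (∃ s < l, i = n + 1 + s) ∨ ∃ d, i = n + 1 + (l + d) := by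
  by_cases h : i ≤ n
  · exact .inl h
  by_cases h' : i - (n + 1) < l
  · exact .inr (.inl ⟨i - (n + 1), h', by omega⟩)
  · exact .inr (.inr ⟨i - (n + 1) - l, by omega⟩)

/-- Since `p n = m`, all values up to `m` have appeared by `n`. The word `τ` adds no new value, and
the tail introduces the remaining ones in order. -/
theorem extendPartition_mem_partitions {p : ℕ → ℕ} {k m n : ℕ} (hm : m + 1 < k)
    (hp : p ∈ partitions k) (hn : p n = m) {τ : List ℕ} (hτ : ∀ a ∈ τ, a < m + 1) :
    extendPartition p k m n τ ∈ partitions k := by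
  obtain ⟨hp1, hp2⟩ := mem_partitions_coe.1 hp
  have hocc : ∀ j ≤ m, ∃ i ≤ n, p i = j := by
    intro j hj
    rcases hj.eq_or_lt with rfl | hj
    · exact ⟨n, le_rfl, hn⟩
    · obtain ⟨i, hi, hpi⟩ := hp1 n m hn j hj
      exact ⟨i, hi.le, hpi⟩
  refine mem_partitions_coe.2 ⟨fun t i hi j hj => ?_, fun j => ⟨?_, fun hj => ?_⟩⟩
  · rcases extendPartition_cases n τ.length t with ht | ⟨s, hs, rfl⟩ | ⟨d, rfl⟩
    · rw [extendPartition_of_le ht] at hi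
      obtain ⟨u, hu, hpu⟩ := hp1 t i hi j hj
      exact ⟨u, hu, by rw [extendPartition_of_le (hu.le.trans ht), hpu]⟩
    · rw [extendPartition_word hs] at hi
      have := hτ _ (List.getElem_mem hs)
      obtain ⟨u, hu, hpu⟩ := hocc j (by omega)
      exact ⟨u, by omega, by rw [extendPartition_of_le hu, hpu]⟩
    · rw [extendPartition_tail] at hi
      by_cases hjm : j ≤ m
      · obtain ⟨u, hu, hpu⟩ := hocc j hjm
        exact ⟨u, by omega, by rw [extendPartition_of_le hu, hpu]⟩
      · refine ⟨n + 1 + (τ.length + (j - (m + 1))), by omega, ?_⟩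
        rw [extendPartition_tail]
        omega
  · rintro ⟨t, rfl⟩
    rcases extendPartition_cases n τ.length t with ht | ⟨s, hs, rfl⟩ | ⟨d, rfl⟩
    · rw [extendPartition_of_le ht]
      exact (hp2 _).1 ⟨t, rfl⟩
    · rw [extendPartition_word hs]
      exact (hτ _ (List.getElem_mem hs)).trans hm
    · rw [extendPartition_tail]
      omega
  · by_cases hjm : j ≤ m
    · obtain ⟨u, hu, hpu⟩ := hocc j hjm
      exact ⟨u, by rw [extendPartition_of_le hu, hpu]⟩
    · refine ⟨n + 1 + (τ.length + (j - (m + 1))), ?_⟩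
      rw [extendPartition_tail]
      omega

/-- The partition which fixes `0, …, n`, and then follows the infinite word `W`: a letter `a` means
the block `ι a`, and the variable `j` means the block `n + 1 + j`. -/
def wordPartition {A : Type*} (ι : A → ℕ) (n : ℕ) (W : ℕ → A ⊕ ℕ) (i : ℕ) : ℕ :=
  if i ≤ n then i else Sum.elim ι (n + 1 + ·) (W (i - (n + 1)))

theorem wordPartition_of_le {A : Type*} {ι : A → ℕ} {n : ℕ} {W : ℕ → A ⊕ ℕ} {i : ℕ} (h : i ≤ n) :
    wordPartition ι n W i = i := if_pos h

theorem wordPartition_word {A : Type*} {ι : A → ℕ} {n : ℕ} {W : ℕ → A ⊕ ℕ} {i : ℕ} :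
    wordPartition ι n W (n + 1 + i) = Sum.elim ι (n + 1 + ·) (W i) := by
  rw [wordPartition, if_neg (by omega), Nat.add_sub_cancel_left]

/-- Letters name only blocks already present, as `ι a ≤ n`. The first occurrences `N J` of the
variables increase with `J`, so new blocks appear in order. -/
theorem wordPartition_mem_partitions {A : Type*} {ι : A → ℕ} {n : ℕ} {W : ℕ → A ⊕ ℕ} {N : ℕ → ℕ}
    (hι : ∀ a, ι a ≤ n) (hN : ∀ J, W (N J) = Sum.inr J)
    (hlt : ∀ J, ∀ i < N J, ∀ j, W i = Sum.inr j → j < J) :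
    wordPartition ι n W ∈ partitions ⊤ := by
  have hmono : ∀ s J J', W s = Sum.inr J → J' < J → N J' < s := by
    intro s J J' hs hJ
    have h1 : N J ≤ s := by
      by_contra! h
      exact lt_irrefl _ (hlt J s h J hs)
    have h2 : N J' < N J := by
      by_contra! h
      rcases h.eq_or_lt with h | h
      · have := hN J
        rw [h, hN J'] at this
        exact hJ.ne (Sum.inr_injective this)
      · exact hJ.not_gt (hlt J' _ h J (hN J))
    omega
  refine mem_partitions_top.2 ⟨fun t i hi j hj => ?_, fun i => ?_⟩
  · by_cases ht : t ≤ n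
    · rw [wordPartition_of_le ht] at hi
      exact ⟨j, by omega, wordPartition_of_le (by omega)⟩
    obtain ⟨s, rfl⟩ := Nat.exists_eq_add_of_le (Nat.not_le.1 ht)
    by_cases hjn : j ≤ n
    · exact ⟨j, by omega, wordPartition_of_le hjn⟩
    rw [Nat.succ_eq_add_one, wordPartition_word] at hi
    rcases hW : W s with a | J
    · have := hι a
      simp only [hW, Sum.elim_inl] at hi
      omega
    · simp only [hW, Sum.elim_inr] at hi
      refine ⟨n + 1 + N (j - (n + 1)), ?_, ?_⟩
      · have := hmono s J (j - (n + 1)) hW (by omega)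
        omega
      · rw [wordPartition_word, hN, Sum.elim_inr]
        omega
  · by_cases h : i ≤ n
    · exact ⟨i, wordPartition_of_le h⟩
    · refine ⟨n + 1 + N (i - (n + 1)), ?_⟩
      rw [wordPartition_word, hN, Sum.elim_inr]
      omega

/-! ### Lowering the level of invariance -/

/-- A coloring `c` of the `k`-partitions is invariant below `m` if the color of `p` only depends
on the part of `p` below the least element of its `m`-th block. -/
def InvariantBelow {K : Type*} (k m : ℕ) (c : (ℕ → ℕ) → K) : Prop :=
  ∀ p ∈ partitions k, ∀ q ∈ partitions k, AgreeBelow m p q → c p = c q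

theorem InvariantBelow.comp {K : Type*} {k m : ℕ} {c : (ℕ → ℕ) → K} (hc : InvariantBelow k m c)
    {x : ℕ → ℕ} (hx : x ∈ partitions ⊤) : InvariantBelow k m fun p => c (p ∘ x) :=
  fun _ hp _ hq h => hc _ (comp_mem_partitions hp hx) _ (comp_mem_partitions hq hx)
    ((agreeBelow_comp_iff hx).2 h)

/-- The color can be made constant on the partitions with a given beginning. -/
theorem exists_const_of_beginning {K : Type*} [Finite K] {k m : ℕ} (hm : m + 1 < k)
    {c : (ℕ → ℕ) → K} (hc : InvariantBelow k (m + 1) c) {n : ℕ} {p₀ : ℕ → ℕ}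
    (hp₀ : p₀ ∈ partitions k) (hn : p₀ n = m) (hle : ∀ i ≤ n, p₀ i ≤ m) :
    ∃ g ∈ partitions ⊤, (∀ i ≤ n, g i = i) ∧
      ∃ κ, ∀ p ∈ partitions k, (∀ i ≤ n, p i = p₀ i) → c (p ∘ g) = κ := by
  have hocc : ∀ a : Fin (m + 1), ∃ i ≤ n, p₀ i = a := by
    intro a
    rcases (Nat.lt_succ_iff.1 a.2).eq_or_lt with h | h
    · exact ⟨n, le_rfl, hn.trans h.symm⟩
    · obtain ⟨i, hi, hpi⟩ := hp₀.1 n m hn a h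
      exact ⟨i, hi.le, hpi⟩
  -- The letter `a` is read as the block of a position `ι a ≤ n` where `p₀` has the value `a`; every
  -- `p` beginning like `p₀` then turns it back into `a`.
  choose ι hι hpι using hocc
  obtain ⟨W, N, κ, hW⟩ := carlson_simpson fun τ : List (Fin (m + 1)) =>
    c (extendPartition p₀ k m n (τ.map Fin.val))
  have hg : wordPartition ι n W ∈ partitions ⊤ :=
    wordPartition_mem_partitions hι (fun J => (hW J).1) (fun J => (hW J).2.1)
  refine ⟨_, hg, fun i hi => wordPartition_of_le hi, κ, fun p hp hpp => ?_⟩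
  obtain ⟨hp1, hp2⟩ := mem_partitions_coe.1 hp
  have hM := apply_blockMin ((hp2 (m + 1)).2 hm)
  have hnM : n + 1 ≤ blockMin p (m + 1) := by
    by_contra! h
    have h1 := hpp _ (Nat.lt_succ_iff.1 h)
    have h2 := hle _ (Nat.lt_succ_iff.1 h)
    omega
  -- As `p` first takes the value `m + 1` at `n + 1 + J`, the composite with the word partition does
  -- so where variable `J` first occurs.
  obtain ⟨J, hJ⟩ := Nat.exists_eq_add_of_le hnM
  have hlt : ∀ i < n + 1 + J, p i < m + 1 := fun i hi => hp1.lt_of_lt_blockMin (hJ ▸ hi)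
  rw [hJ] at hM
  obtain ⟨hNJ, hvar, hcol⟩ := hW J
  -- Only variables `j < J` occur before `N J`; for these `p (n + 1 + j) < m + 1`, so reduction
  -- modulo `m + 1` changes nothing.
  rw [← hcol fun j => Fin.ofNat (m + 1) (p (n + 1 + j))]
  refine hc _ (comp_mem_partitions hp hg) _
    (extendPartition_mem_partitions hm hp₀ hn fun b hb => ?_)
    ⟨n + 1 + N J, fun i hi => ?_, ?_, ?_⟩
  · obtain ⟨a, -, rfl⟩ := List.mem_map.1 hb
    exact a.2
  · by_cases hin : i ≤ n
    · rw [extendPartition_of_le hin, Function.comp_apply, wordPartition_of_le hin]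
      exact ⟨hpp i hin, hlt i (by omega)⟩
    obtain ⟨s, rfl⟩ := Nat.exists_eq_add_of_le (Nat.not_le.1 hin)
    rw [Nat.succ_eq_add_one] at hi ⊢
    have hs : s < N J := by omega
    rw [extendPartition_word (by simpa [substVars] using hs), Function.comp_apply,
      wordPartition_word]
    simp only [substVars, List.getElem_map, List.getElem_range]
    rcases hWs : W s with a | j
    · simp only [Sum.elim_inl, id]
      rw [hpp _ (hι a), hpι a]
      exact ⟨rfl, a.2⟩
    · have hj := hlt (n + 1 + j) (by have := hvar s hs j hWs; omega)
      simp only [Sum.elim_inr, Fin.val_ofNat]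
      exact ⟨(Nat.mod_eq_of_lt hj).symm, hj⟩
  · rw [Function.comp_apply, wordPartition_word, hNJ, Sum.elim_inr, hM]
  -- With `d = 0` the tail starts at `min (m + 1) (k - 1) = m + 1`, so `m + 1` comes immediately
  -- after the word.
  · have := extendPartition_tail (p := p₀) (k := k) (m := m) (n := n) (d := 0)
      (τ := (substVars (fun j => Fin.ofNat (m + 1) (p (n + 1 + j)))
        ((List.range (N J)).map W)).map Fin.val)
    simp only [substVars, List.length_map, List.length_range, Nat.add_zero] at this
    rw [substVars, this]
    omega

/-- The color of a partition `p` with first occurrence of `m` at `n` can be made to depend only on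
`p 0, …, p n`. -/
theorem exists_const_of_all_beginnings {K : Type*} [Finite K] {k m : ℕ} (hm : m + 1 < k)
    {c : (ℕ → ℕ) → K} (hc : InvariantBelow k (m + 1) c) (n : ℕ) :
    ∃ g ∈ partitions ⊤, (∀ i ≤ n, g i = i) ∧ ∀ p ∈ partitions k, ∀ q ∈ partitions k,
      (∀ i ≤ n, p i = q i) → (∀ i ≤ n, p i ≤ m) → p n = m → c (p ∘ g) = c (q ∘ g) := by
  have key : ∀ F : Finset (Fin (n + 1) → ℕ), ∃ g ∈ partitions ⊤, (∀ i ≤ n, g i = i) ∧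
      ∀ p ∈ partitions k, ∀ q ∈ partitions k, (fun i : Fin (n + 1) => p i) ∈ F →
        (∀ i ≤ n, p i = q i) → (∀ i ≤ n, p i ≤ m) → p n = m → c (p ∘ g) = c (q ∘ g) := by
    intro F
    induction F using Finset.induction_on with
    | empty => exact ⟨id, id_mem_partitions_top, fun _ _ => rfl, by simp⟩
    | insert σ F _ ih =>
      obtain ⟨g, hg, hgn, hgF⟩ := ih
      -- A beginning `σ` that no suitable partition realizes imposes no condition. Otherwise `g'`
      -- treats `σ` and, fixing `0, …, n`, preserves what holds on `F`.
      by_cases h : ∃ p₀ ∈ partitions k, (fun i : Fin (n + 1) => p₀ i) = σ ∧ p₀ n = m ∧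
          ∀ i ≤ n, p₀ i ≤ m
      · obtain ⟨p₀, hp₀, rfl, hpn, hple⟩ := h
        obtain ⟨g', hg', hgn', κ, hκ⟩ := exists_const_of_beginning hm (hc.comp hg) hp₀ hpn hple
        refine ⟨g' ∘ g, comp_mem_partitions hg' hg, fun i hi => ?_,
          fun p hp q hq hF hpq hpm hpnm => ?_⟩
        · rw [Function.comp_apply, hgn i hi, hgn' i hi]
        rcases Finset.mem_insert.1 hF with hσ | hF
        · have hpp : ∀ i ≤ n, p i = p₀ i := fun i hi =>
            congrFun hσ ⟨i, Nat.lt_succ_iff.2 hi⟩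
          exact (hκ p hp hpp).trans (hκ q hq fun i hi => (hpq i hi).symm.trans (hpp i hi)).symm
        · have heq : ∀ r : ℕ → ℕ, ∀ i ≤ n, (r ∘ g') i = r i := fun r i hi => by
            rw [Function.comp_apply, hgn' i hi]
          refine hgF (p ∘ g') (comp_mem_partitions hp hg') (q ∘ g') (comp_mem_partitions hq hg')
            ?_ (fun i hi => ?_) (fun i hi => ?_) ?_
          · convert hF using 2 with i
            exact heq p i (Nat.lt_succ_iff.1 i.2)
          · rw [heq p i hi, heq q i hi, hpq i hi]
          · rw [heq p i hi]
            exact hpm i hi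
          · rw [heq p n le_rfl, hpnm]
      · refine ⟨g, hg, hgn, fun p hp q hq hF hpq hpm hpnm => ?_⟩
        rcases Finset.mem_insert.1 hF with hσ | hF
        · exact absurd ⟨p, hp, hσ, hpnm, hpm⟩ h
        · exact hgF p hp q hq hF hpq hpm hpnm
  obtain ⟨g, hg, hgn, hgF⟩ := key (Fintype.piFinset fun _ => Finset.range (m + 1))
  refine ⟨g, hg, hgn, fun p hp q hq hpq hpm hpnm => hgF p hp q hq ?_ hpq hpm hpnm⟩
  rw [Fintype.mem_piFinset]
  exact fun i => Finset.mem_range.2 (Nat.lt_succ_iff.2 (hpm i (Nat.lt_succ_iff.1 i.2)))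

/-- The limit of a fusion sequence of infinite partitions. -/
theorem exists_fusion (X g : ℕ → ℕ → ℕ) (hX : ∀ n, X n ∈ partitions ⊤)
    (hXg : ∀ n, X (n + 1) = g n ∘ X n) (hg : ∀ n, ∀ i ≤ n, g n i = i) :
    ∃ x ∈ partitions ⊤, ∀ n, ∃ h ∈ partitions ⊤, x = h ∘ X n ∧ ∀ i ≤ n, h i = i := by
  -- Values at most `n` never change after stage `n`. As `X t t ≤ t`, the diagonal `X t t` is the
  -- pointwise limit.
  have hfix : ∀ n s, X n s ≤ n → ∀ N ≥ n, X N s = X n s := by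
    intro n s hs N hN
    induction N, hN using Nat.le_induction with
    | base => rfl
    | succ N hN ih => rw [hXg, Function.comp_apply, ih, hg N _ (hs.trans hN)]
  have hlim : ∀ t, ∀ N ≥ t, X N t = X t t := fun t => hfix t t ((hX t).1.le t)
  have hcoarse : ∀ n s t, X n s = X n t → ∀ N ≥ n, X N s = X N t := by
    intro n s t h N hN
    induction N, hN using Nat.le_induction with
    | base => exact h
    | succ N hN ih => rw [hXg, Function.comp_apply, Function.comp_apply, ih]
  have hx : (fun t => X t t) ∈ partitions ⊤ := by
    refine mem_partitions_top.2 ⟨fun n i hi j hj => ?_, fun i => ?_⟩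
    · obtain ⟨m, hm, hXm⟩ := (hX n).1 n i hi j hj
      exact ⟨m, hm, by rw [← hXm, hlim m n hm.le]⟩
    · obtain ⟨t, ht⟩ := (mem_partitions_top.1 (hX i)).2 i
      refine ⟨t, ?_⟩
      change X t t = i
      rw [← hlim t (max i t) (le_max_right _ _), hfix i t ht.le _ (le_max_left _ _), ht]
  refine ⟨_, hx, fun n => ?_⟩
  obtain ⟨h, hh, hxh⟩ := exists_comp_of_mem_coarsenings (k := ⊤) (hX n)
    (q := fun t => X t t) ⟨hx, fun s t hst => by
      change X s s = X t t
      rw [← hlim s (max n (max s t)) (by simp), ← hlim t (max n (max s t)) (by simp)]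
      exact hcoarse n s t hst _ (le_max_left _ _)⟩
  refine ⟨h, hh, hxh, fun i hi => ?_⟩
  obtain ⟨s, rfl⟩ := (mem_partitions_top.1 (hX n)).2 i
  rw [← Function.comp_apply (f := h), ← hxh]
  change X s s = X n s
  rw [← hlim s (max n s) (le_max_right _ _), hfix n s hi _ (le_max_left _ _)]

/-- A coloring which is invariant below `m + 1` is invariant below `m` on the coarsenings of some
infinite partition. -/
theorem InvariantBelow.exists_pred {K : Type*} [Finite K] {k m : ℕ} (hm : m + 1 < k)
    {c : (ℕ → ℕ) → K} (hc : InvariantBelow k (m + 1) c) :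
    ∃ x ∈ partitions ⊤, InvariantBelow k m fun p => c (p ∘ x) := by
  have hstep : ∀ (n : ℕ) (x : {x // x ∈ partitions ⊤}), ∃ g ∈ partitions ⊤, (∀ i ≤ n, g i = i) ∧
      ∀ p ∈ partitions k, ∀ q ∈ partitions k, (∀ i ≤ n, p i = q i) → (∀ i ≤ n, p i ≤ m) →
        p n = m → c ((p ∘ g) ∘ x) = c ((q ∘ g) ∘ x) :=
    fun n x => exists_const_of_all_beginnings hm (hc.comp x.2) n
  choose G hG hGn hGc using hstep
  let X : ℕ → {x // x ∈ partitions ⊤} := fun n =>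
    Nat.rec ⟨id, id_mem_partitions_top⟩
      (fun n x => ⟨G n x ∘ x, comp_mem_partitions (hG n x) x.2⟩) n
  obtain ⟨x, hx, hxX⟩ := exists_fusion (fun n => (X n).1) (fun n => G n (X n)) (fun n => (X n).2)
    (fun _ => rfl) (fun n => hGn n (X n))
  refine ⟨x, hx, fun p hp q hq ⟨n, hpq, hpn, hqn⟩ => ?_⟩
  -- Stage `n + 1` is the first that includes `G n`. There `p ∘ x = ((p ∘ h) ∘ G n (X n)) ∘ X n`,
  -- and `p ∘ h` begins like `p` up to `n`.
  obtain ⟨h, hh, hxh, hfix⟩ := hxX (n + 1)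
  have heq : ∀ r : ℕ → ℕ, ∀ i ≤ n, (r ∘ h) i = r i := fun r i hi => by
    rw [Function.comp_apply, hfix i (hi.trans n.le_succ)]
  have hall : ∀ i ≤ n, p i = q i ∧ p i ≤ m := fun i hi => by
    rcases hi.eq_or_lt with rfl | hi
    · exact ⟨hpn.trans hqn.symm, hpn.le⟩
    · exact ⟨(hpq i hi).1, (hpq i hi).2.le⟩
  have := hGc n (X n) (p ∘ h) (comp_mem_partitions hp hh) (q ∘ h) (comp_mem_partitions hq hh)
    (fun i hi => by rw [heq p i hi, heq q i hi, (hall i hi).1])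
    (fun i hi => by rw [heq p i hi]; exact (hall i hi).2) (by rw [heq p n le_rfl, hpn])
  simp only
  rw [hxh]
  exact this

/-- A coloring of the `k`-partitions which is invariant below some `m < k` is constant on the
coarsenings of some infinite partition. -/
theorem InvariantBelow.exists_const {K : Type*} [Finite K] {k m : ℕ} (hm : m < k)
    {c : (ℕ → ℕ) → K} (hc : InvariantBelow k m c) :
    ∃ x ∈ partitions ⊤, ∀ p ∈ partitions k, ∀ q ∈ partitions k, c (p ∘ x) = c (q ∘ x) := by
  induction m generalizing c with
  | zero =>
    exact ⟨id, id_mem_partitions_top, fun p hp q hq => hc p hp q hq (agreeBelow_zero hp hq)⟩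
  | succ m ih =>
    obtain ⟨x, hx, hcx⟩ := hc.exists_pred hm
    obtain ⟨x', hx', h⟩ := ih (by omega) hcx
    exact ⟨x' ∘ x, comp_mem_partitions hx' hx, h⟩

/-! ### Back to reduced colorings -/

theorem min_mem_partitions {k : ℕ} (hk : 0 < k) : (fun i => min i (k - 1)) ∈ partitions k := by
  refine mem_partitions_coe.2 ⟨fun n i hi j hj => ⟨j, ?_, ?_⟩, fun i => ⟨?_, fun hi => ⟨i, ?_⟩⟩⟩
  · simp only at hi; omega
  · simp only at hi ⊢; omega
  · rintro ⟨n, rfl⟩; omega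
  · omega

/-- Colors may overlap, so the full set of colors of a partition serves as its single color; there
are finitely many such sets. -/
theorem IsMReduced.invariantBelow {ℓ k m : ℕ} (hm : m < k) {y : ℕ → ℕ} (hy : y ∈ partitions ⊤)
    {C : Fin ℓ → Set (ℕ → ℕ)} (hC : IsMReduced y k m C) :
    InvariantBelow k m fun p => {i | p ∘ y ∈ C i} := by
  intro p hp q hq h
  ext i
  refine hC _ (comp_mem_coarsenings hp hy) _ (comp_mem_coarsenings hq hy) ?_ i
  rw [initialString_eq_iff_agreeBelow hm (comp_mem_partitions hp hy) (comp_mem_partitions hq hy),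
    agreeBelow_comp_iff hy]
  exact h

theorem exists_isMReduced_pred {ℓ k m : ℕ} (hm : m + 1 < k) {y : ℕ → ℕ} (hy : y ∈ partitions ⊤)
    {C : Fin ℓ → Set (ℕ → ℕ)} (hC : IsMReduced y k (m + 1) C) :
    ∃ x ∈ coarsenings y ⊤, IsMReduced x k m (restrictColoring x k C) := by
  obtain ⟨x, hx, hcx⟩ := (hC.invariantBelow hm hy).exists_pred hm
  have hxy := comp_mem_partitions hx hy
  refine ⟨x ∘ y, comp_mem_coarsenings hx hy, fun p hp q hq h i => ?_⟩
  rw [initialString_eq_iff_agreeBelow (by omega) hp.1 hq.1] at h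
  have key : p ∈ C i ↔ q ∈ C i := by
    obtain ⟨p, hp', rfl⟩ := exists_comp_of_mem_coarsenings hxy hp
    obtain ⟨q, hq', rfl⟩ := exists_comp_of_mem_coarsenings hxy hq
    exact Set.ext_iff.1 (hcx p hp' q hq' ((agreeBelow_comp_iff hxy).1 h)) i
  exact and_congr key (iff_of_true hp hq)

theorem exists_homogeneous_of_reduced {ℓ k : ℕ} (hk : 2 ≤ k) {y : ℕ → ℕ} (hy : y ∈ partitions ⊤)
    {C : Fin ℓ → Set (ℕ → ℕ)} (hcol : IsColoring y k C) (hC : IsMReduced y k (k - 1) C) :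
    ∃ p ∈ coarsenings y ⊤, ∃ i, coarsenings p k ⊆ C i := by
  obtain ⟨x, hx, hcx⟩ := (hC.invariantBelow (by omega) hy).exists_const (by omega)
  -- The set of colors is now constant; one explicit `k`-partition shows that it is nonempty.
  have hmin := min_mem_partitions (k := k) (by omega)
  have hmem := comp_mem_coarsenings (comp_mem_partitions hmin hx) hy
  rw [hcol] at hmem
  obtain ⟨i, hi⟩ := Set.mem_iUnion.1 hmem
  refine ⟨x ∘ y, comp_mem_coarsenings hx hy, i, fun q hq => ?_⟩
  obtain ⟨q, hq', rfl⟩ := exists_comp_of_mem_coarsenings (comp_mem_partitions hx hy) hq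
  exact (Set.ext_iff.1 (hcx q hq' _ hmin) i).2 hi

theorem initialString_mem_finPartitions {k m : ℕ} (hm : m < k) {p : ℕ → ℕ}
    (hp : p ∈ partitions k) : initialString p (blockMin p m) ∈ finPartitions m := by
  obtain ⟨hp1, hp2⟩ := mem_partitions_coe.1 hp
  have hget : ∀ N n i, (initialString p N)[n]? = some i ↔ n < N ∧ p n = i := by
    intro N n i
    simp only [initialString, List.getElem?_map, Option.map_eq_some_iff, List.getElem?_eq_some_iff,
      List.getElem_range, List.length_range]
    constructor
    · rintro ⟨a, ⟨h, rfl⟩, h'⟩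
      exact ⟨h, h'⟩
    · rintro ⟨h, h'⟩
      exact ⟨n, ⟨h, rfl⟩, h'⟩
  refine ⟨fun n i h j hj => ?_, fun i => ⟨fun h => ?_, fun h => ?_⟩⟩
  · rw [hget] at h
    obtain ⟨n', hn', rfl⟩ := hp1 n i h.2 j hj
    exact ⟨n', hn', (hget _ _ _).2 ⟨hn'.trans h.1, rfl⟩⟩
  · obtain ⟨n, hn, rfl⟩ := List.mem_map.1 h
    exact hp1.lt_of_lt_blockMin (List.mem_range.1 hn)
  · obtain ⟨n, hn, rfl⟩ := hp1 _ m (apply_blockMin ((hp2 m).2 hm)) i h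
    exact List.mem_map_of_mem (List.mem_range.2 hn)

/-- Coloring each `k`-partition by its string below the last block is a reduced coloring, and the
coarsenings of `id` are all `k`-partitions. -/
theorem combinatorial_dual_ramsey {k ℓ : ℕ} (hk : 2 ≤ k) : CDRT k ℓ := by
  intro C hC
  have hid : ∀ p, p ∈ coarsenings id k ↔ p ∈ partitions k :=
    fun p => ⟨fun h => h.1, fun h => ⟨h, fun _ _ e => congrArg p e⟩⟩
  let C' : Fin ℓ → Set (ℕ → ℕ) :=
    fun i => {p | p ∈ partitions k ∧ initialString p (blockMin p (k - 1)) ∈ C i}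
  have hcol : IsColoring id k C' := by
    ext p
    simp only [C', hid, Set.mem_iUnion, Set.mem_ofPred_eq, exists_and_left]
    refine ⟨fun hp => ⟨hp, ?_⟩, fun h => h.1⟩
    have := initialString_mem_finPartitions (m := k - 1) (by omega) hp
    rw [hC] at this
    exact Set.mem_iUnion.1 this
  have hred : IsMReduced id k (k - 1) C' := by
    intro p hp q hq h i
    rw [hid] at hp hq
    simp only [C', Set.mem_ofPred_eq, hp, hq, h]
  obtain ⟨p, hp, i, hi⟩ := exists_homogeneous_of_reduced hk id_mem_partitions_top hcol hred
  exact ⟨p, hp.1, i, fun x hx => (hi hx).2⟩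

end DualRamsey

theorem mainTheorem8 :
    -- every `m`-reduced coloring of `(y)^k` is `(m-1)`-reduced on some `(x)^k`, `x ∈ (y)^ω`
    (∀ k m ℓ : ℕ, 1 < m → m < k →
      ∀ y ∈ DualRamsey.partitions ⊤, ∀ C : Fin ℓ → Set (ℕ → ℕ),
        DualRamsey.IsColoring y k C → DualRamsey.IsMReduced y k m C →
          ∃ x ∈ DualRamsey.coarsenings y ⊤,
            DualRamsey.IsMReduced x k (m - 1) (DualRamsey.restrictColoring x k C)) ∧
    -- every reduced coloring of `(y)^k` has a homogeneous `p ∈ (y)^ω`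
    (∀ k ℓ : ℕ, 2 ≤ k →
      ∀ y ∈ DualRamsey.partitions ⊤, ∀ C : Fin ℓ → Set (ℕ → ℕ),
        DualRamsey.IsColoring y k C → DualRamsey.IsMReduced y k (k - 1) C →
          ∃ p ∈ DualRamsey.coarsenings y ⊤, ∃ i, DualRamsey.coarsenings p k ⊆ C i) ∧
    -- the Combinatorial Dual Ramsey Theorem
    (∀ k ℓ : ℕ, 2 ≤ k → DualRamsey.CDRT k ℓ) := by
  refine ⟨fun k m ℓ h1 hmk y hy C _ hC => ?_,
    fun k ℓ hk y hy C hcol hC => DualRamsey.exists_homogeneous_of_reduced hk hy hcol hC,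
    fun k ℓ hk => DualRamsey.combinatorial_dual_ramsey hk⟩
  obtain ⟨m, rfl⟩ : ∃ n, m = n + 1 := ⟨m - 1, by omega⟩
  exact DualRamsey.exists_isMReduced_pred hmk hy hC
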